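/- An $m$-part sum system for $N$ is an $m$-tuple $(A_1,\dots,A_m)$ of finite sets of non-negative integers with $|A_1|\cdots|A_m|=N$ and $A_1+\cdots+A_m=\{0,1,\dots,N-1\}$ (Minkowski sum). For integers $m\ge 0$ and $N\ge 1$ let $\mathcal N_m(N)$ be the number of $m$-part sum systems for $N$ in which every part satisfies $|A_j|\ge 2$ (so $\mathcal N_0(1)=1$ and $\mathcal N_0(N)=0$ for $N\ge 2$, the empty Minkowski sum being $\{0\}$), and put $\mathcal M_m(N)=\frac{1}{m!}\mathcal N_m(N)$. The centred sum system of $(A_1,\dots,A_m)$ is $(C_1,\dots,C_m)$ with $C_j=A_j-\frac12\max A_j$. A joint ordered factorisation of $(n_1,\dots,n_m)$, where all $n_j\ge 2$, is a finite sequence $((j_1,f_1),\dots,(j_L,f_L))$ with $j_\ell\in\{1,\dots,m\}$, integers $f_\ell\ge 2$, $j_\ell\ne j_{\ell-1}$ for $2\le \ell\le L$, and $\prod_{\ell:\,j_\ell=j}f_\ell=n_j$ for every $j$. **Theorem.** Let $m\ge 1$ and $N\ge 2$ be integers. Then $\mathcal N_m(N)$ is also the number of centred sum systems of the $m$-part sum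 systems for $N$ all of whose parts have at least two elements, and the number of joint ordered factorisations of all the $m$-tuples $(n_1,\dots,n_m)$ of integers $\ge 2$ with $n_1\cdots n_m=N$; and $$\mathcal N_m(N)=\sum_{d\mid N,\ d<N}\bigl((m-1)\,\mathcal N_m(d)+m\,\mathcal N_{m-1}(d)\bigr)=-m\sum_{d\mid N,\ d<N}\mu\!\left(\frac Nd\right)\bigl(\mathcal N_m(d)+\mathcal N_{m-1}(d)\bigr),$$ where $\mu$ is the Möbius function. Moreover, $\mathcal M_m(N)$ is the number of $m$-part sum systems for $N$ with all parts of size at least two, counted up to permutation of the parts, and likewise the number of the corresponding centred sum systems up to permutation of the parts; and $$\mathcal M_m(N)=\sum_{d\mid N,\ d<N}\bigl((m-1)\,\mathcal M_m(d)+\mathcal M_{m-1}(d)\bigr)=-\sum_{d\mid N,\ d<N}\mu\!\left(\frac Nd\right)\bigl(m\,\mathcal M_m(d)+\mathcal M_{m-1}(d)\bigr).$$ -/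

import Mathlib

open scoped Pointwise

/-- `A 0, …, A (m-1)` is an `m`-part sum system for `N`: the cardinalities multiply to `N` and
the Minkowski sum of the parts is `{0, 1, …, N - 1}`. -/
def IsSumSystem {m : ℕ} (N : ℕ) (A : Fin m → Finset ℕ) : Prop :=
  ∏ j, (A j).card = N ∧ ∑ j, A j = Finset.range N

/-- The `m`-part sum systems for `N`, all of whose parts have at least two elements. -/
def sumSystems (m N : ℕ) : Set (Fin m → Finset ℕ) :=
  {A | IsSumSystem N A ∧ ∀ j, 2 ≤ (A j).card}

/-- There are finitely many such systems: every part is contained in `{0, …, N - 1}`. -/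
theorem sumSystems_finite (m N : ℕ) : (sumSystems m N).Finite := by
  refine Set.Finite.subset
    (Fintype.piFinset fun _ : Fin m => (Finset.range N).powerset).finite_toSet ?_
  rintro A ⟨⟨_, hs⟩, hc⟩
  simp only [Finset.mem_coe, Fintype.mem_piFinset, Finset.mem_powerset]
  intro j a ha
  have hne : ∀ i, (A i).Nonempty := fun i =>
    Finset.card_pos.mp (lt_of_lt_of_le (by norm_num) (hc i))
  choose b hb using hne
  have hmem : ∑ i, Function.update b j a i ∈ ∑ i, A i := by
    rw [← Finset.mem_coe, Finset.coe_sum]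
    apply Set.finsetSum_mem_finsetSum
    intro i _
    by_cases h : i = j
    · subst h; simpa using ha
    · simpa [h] using hb i
  rw [hs, Finset.mem_range] at hmem
  have hle : Function.update b j a j ≤ ∑ i, Function.update b j a i :=
    Finset.single_le_sum (fun _ _ => Nat.zero_le _) (Finset.mem_univ j)
  rw [Function.update_self] at hle
  exact Finset.mem_range.mpr (lt_of_le_of_lt hle hmem)

/-- The centred component `A - (max A) / 2`. -/
def centre (A : Finset ℕ) : Finset ℚ :=
  A.image fun a : ℕ => (a : ℚ) - ((A.sup id : ℕ) : ℚ) / 2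

/-- The `m`-part centred sum systems for `N`, all of whose parts have at least two elements. -/
def centredSumSystems (m N : ℕ) : Set (Fin m → Finset ℚ) :=
  {C | ∃ A ∈ sumSystems m N, ∀ j, C j = centre (A j)}

/-- The chain `(j₁, f₁), …, (j_L, f_L)` is a joint ordered factorisation of `(n₁, …, n_m)`: all
factors are at least two, consecutive factors belong to different indices, and the factors
that belong to the index `j` multiply to `n_j`. -/
def IsJointOrderedFactorisation {m : ℕ} (n : Fin m → ℕ) (l : List (Fin m × ℕ)) : Prop :=
  (∀ p ∈ l, 2 ≤ p.2) ∧ l.IsChain (fun p q => p.1 ≠ q.1) ∧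
    ∀ j, ((l.filter fun p => p.1 = j).map Prod.snd).prod = n j

/-- The joint ordered factorisations of all `m`-tuples of integers `≥ 2` with product `N`. -/
def jointOrderedFactorisations (m N : ℕ) : Set (List (Fin m × ℕ)) :=
  {l | ∃ n : Fin m → ℕ, (∀ j, 2 ≤ n j) ∧ ∏ j, n j = N ∧ IsJointOrderedFactorisation n l}

/-- The number `𝒩_m(N)` of `m`-part sum systems for `N`. -/
noncomputable def numSumSystems (m N : ℕ) : ℕ := (sumSystems m N).ncard

/-- `ℳ_m(N) = 𝒩_m(N) / m!`. -/
noncomputable def normSumSystems (m N : ℕ) : ℚ := (numSumSystems m N : ℚ) / (m.factorial : ℚ)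

/-- The families in `S`, regarded up to permutation of their `m` members. -/
def unordered {α : Type*} {m : ℕ} (S : Set (Fin m → α)) : Set (Multiset α) :=
  (fun A => (Finset.univ : Finset (Fin m)).val.map A) '' S

/-! Sum systems are built up one factor at a time. If `N ≥ 2`, some part contains `1`; let `f` be
the first number missing from that part `j`. Unique representation forces part `j` to be a union of
blocks of length `f` and all other parts to consist of multiples of `f`
(`dvd_and_mem_iff_of_add_eq_range`). Dividing by `f` leaves a sum system for `N / f` whose part `j`
lacks `1`. Iteration gives a chain of pairs `(j, f)` with consecutive indices distinct, and the
chain can be read back from the system (`systemOfChain_injOn`), so systems correspond to joint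
ordered factorisations.

Chains are counted by removing the first pair. A tail with product `d` either still uses all `m`
indices, and then `j` is any index but its first one (`m - 1` choices), or misses exactly `j` (`m`
choices). This is the first recurrence, and Möbius inversion gives the second. Distinct parts meet
only in `0`, so permutations act freely and division by `m!` counts unordered systems. -/

/-! ### Inflation of sum systems -/

section Inflation

variable {ι : Type*} [DecidableEq ι]

/-- Replace every part `B i` by `f * B i`, and add the block `{0, …, f - 1}` to the part `j`. -/
def inflate (j : ι) (f : ℕ) (B : ι → Finset ℕ) (i : ι) : Finset ℕ :=
  (if i = j then Finset.range f else 0) + (B i).image (f * ·)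

theorem mem_range_add_image_mul {f : ℕ} (hf : 0 < f) (S : Finset ℕ) (x : ℕ) :
    x ∈ Finset.range f + S.image (f * ·) ↔ x / f ∈ S := by
  simp only [Finset.mem_add, Finset.mem_range, Finset.mem_image]
  constructor
  · rintro ⟨r, hr, _, ⟨y, hy, rfl⟩, rfl⟩
    rwa [Nat.add_mul_div_left _ _ hf, Nat.div_eq_of_lt hr, zero_add]
  · intro h
    exact ⟨x % f, Nat.mod_lt _ hf, _, ⟨_, h, rfl⟩, Nat.mod_add_div x f⟩

theorem mem_inflate {j : ι} {f : ℕ} (hf : 0 < f) {B : ι → Finset ℕ} {i : ι} {x : ℕ} :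
    x ∈ inflate j f B i ↔ x / f ∈ B i ∧ (i = j ∨ f ∣ x) := by
  unfold inflate
  split_ifs with h
  · simp [mem_range_add_image_mul hf, h]
  · simp only [zero_add, Finset.mem_image, h, false_or]
    constructor
    · rintro ⟨y, hy, rfl⟩
      simpa [Nat.mul_div_cancel_left _ hf] using hy
    · rintro ⟨h1, h2⟩
      exact ⟨_, h1, Nat.mul_div_cancel' h2⟩

theorem card_inflate {j : ι} {f : ℕ} (hf : 0 < f) (B : ι → Finset ℕ) (i : ι) :
    (inflate j f B i).card = (if i = j then f else 1) * (B i).card := by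
  have hinj : Function.Injective (f * · : ℕ → ℕ) := fun a b h => Nat.eq_of_mul_eq_mul_left hf h
  unfold inflate
  split_ifs with h
  · rw [Finset.card_add_iff.mpr, Finset.card_range, Finset.card_image_of_injective _ hinj]
    rintro ⟨a, b⟩ hab ⟨c, d⟩ hcd h
    simp only [Set.mem_prod, Finset.mem_coe, Finset.mem_range, Finset.mem_image] at hab hcd h
    obtain ⟨ha, y, -, rfl⟩ := hab
    obtain ⟨hc, z, -, rfl⟩ := hcd
    -- The residue mod `f` recovers the summand from the block.
    have h1 := congrArg (· % f) h
    simp only [Nat.add_mul_mod_self_left, Nat.mod_eq_of_lt ha, Nat.mod_eq_of_lt hc] at h1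
    rw [Prod.mk.injEq]
    omega
  · rw [zero_add, one_mul, Finset.card_image_of_injective _ hinj]

theorem sum_inflate [Fintype ι] (j : ι) (f : ℕ) (B : ι → Finset ℕ) :
    ∑ i, inflate j f B i = Finset.range f + (∑ i, B i).image (f * ·) := by
  unfold inflate
  rw [Finset.sum_add_distrib, Finset.sum_ite_eq' Finset.univ j, if_pos (Finset.mem_univ j)]
  congr 1
  exact (map_sum (Finset.imageAddMonoidHom (AddMonoidHom.mulLeft f)) B Finset.univ).symm

theorem range_add_image_mul_eq_range_iff {f : ℕ} (hf : 0 < f) (S : Finset ℕ) (d : ℕ) :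
    Finset.range f + S.image (f * ·) = Finset.range (f * d) ↔ S = Finset.range d := by
  simp only [Finset.ext_iff, mem_range_add_image_mul hf, Finset.mem_range]
  constructor
  · intro h x
    simpa [Nat.mul_div_cancel_left _ hf, hf] using h (f * x)
  · intro h x
    rw [h, Nat.div_lt_iff_lt_mul hf, mul_comm]

theorem isSumSystem_inflate_iff {m : ℕ} {f : ℕ} (hf : 0 < f) (j : Fin m) (d : ℕ)
    (B : Fin m → Finset ℕ) : IsSumSystem (f * d) (inflate j f B) ↔ IsSumSystem d B := by
  unfold IsSumSystem
  simp only [sum_inflate, range_add_image_mul_eq_range_iff hf, card_inflate hf,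
    Finset.prod_mul_distrib, Finset.prod_ite_eq', Finset.mem_univ, if_true]
  rw [Nat.mul_right_inj hf.ne']

end Inflation

/-! ### De Bruijn's decomposition -/

section Tiling

/-- A sumset `A + B` with unique representations that fills an interval: if `f` is the first
number missing from `A`, then `B` consists of multiples of `f`, and `A` of full blocks of
length `f`. -/
theorem dvd_and_mem_iff_of_add_eq_range {A B : Finset ℕ} {N f : ℕ}
    (hAB : A + B = Finset.range N)
    (hinj : (A ×ˢ B : Set (ℕ × ℕ)).InjOn fun p => p.1 + p.2)
    (hB : 0 ∈ B) (hf0 : 0 < f) (hlt : ∀ r < f, r ∈ A) (hf : f ∉ A) (n : ℕ) :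
    (n ∈ B → f ∣ n) ∧ (n ∈ A ↔ f * (n / f) ∈ A) := by
  have hA : 0 ∈ A := hlt 0 hf0
  have uniq : ∀ {a b c d}, a ∈ A → b ∈ B → c ∈ A → d ∈ B → a + b = c + d → a = c ∧ b = d := by
    intro a b c d ha hb hc hd h
    simpa using hinj (Set.mk_mem_prod ha hb) (Set.mk_mem_prod hc hd) h
  have exist : ∀ {n}, n < N → ∃ a ∈ A, ∃ b ∈ B, a + b = n := by
    intro n hn
    rwa [← Finset.mem_range, ← hAB, Finset.mem_add] at hn
  have bound : ∀ {a b}, a ∈ A → b ∈ B → a + b < N := by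
    intro a b ha hb
    rw [← Finset.mem_range, ← hAB]
    exact Finset.add_mem_add ha hb
  -- In `f = a + b` a nonzero `b < f` would have the two representations `b + 0` and `0 + b`, while
  -- `b = 0` would put `f` into `A`.
  have hfB : f < N → f ∈ B := by
    intro h
    obtain ⟨a, ha, b, hb, hab⟩ := exist h
    rcases Nat.lt_or_ge b f with hbf | hbf
    · obtain ⟨h1, h2⟩ := uniq (hlt b hbf) hB hA hb (by omega)
      exact absurd (by rwa [show f = a by omega]) hf
    · rwa [show f = b by omega]
  induction n using Nat.strong_induction_on with
  | _ n ih =>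
  obtain ⟨k, r, hr, rfl⟩ : ∃ k r, r < f ∧ n = f * k + r :=
    ⟨n / f, n % f, Nat.mod_lt _ hf0, (Nat.div_add_mod n f).symm⟩
  have hdiv : (f * k + r) / f = k := by
    rw [Nat.mul_add_div hf0, Nat.div_eq_of_lt hr, add_zero]
  rw [hdiv]
  rcases Nat.eq_zero_or_pos r with rfl | hr0
  · simp
  -- inside a block, membership in `A` does not change
  have shift : ∀ a, f ∣ a → a < f * k → (a ∈ A ↔ a + r ∈ A) := by
    rintro _ ⟨q, rfl⟩ hq
    rw [(ih (f * q + r) (by omega)).2, Nat.mul_add_div hf0, Nat.div_eq_of_lt hr, add_zero]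
  have split : f * k < N → ∃ q, f * q ∈ A ∧ ∃ b ∈ B, f * q + b = f * k := by
    intro h
    obtain ⟨a, ha, b, hb, hab⟩ := exist h
    obtain ⟨q, rfl⟩ : f ∣ a := by
      have := (ih b (by omega)).1 hb
      exact (Nat.dvd_add_iff_left this).mpr ⟨k, hab⟩
    exact ⟨q, ha, b, hb, hab⟩
  -- If `f * k = f * q + b` with `q < k`, the clash is `(f * q + r) + b = 0 + n`. If `f * k ∈ A`
  -- with `k > 0`, it is `f * k + f = (f - r) + n`.
  have hnB : f * k + r ∉ B := by
    intro hn
    have hnN := bound hA hn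
    obtain ⟨q, hq, b, hb, hab⟩ := split (by omega)
    rcases Nat.lt_or_ge (f * q) (f * k) with hlt' | hge
    · have := uniq ((shift _ ⟨q, rfl⟩ hlt').mp hq) hb hA hn (by omega)
      omega
    · rw [show f * q = f * k by omega] at hq
      rcases Nat.eq_zero_or_pos k with rfl | hk
      · have := uniq (hlt r hr) hB hA hn (by simp)
        omega
      · have hfk : f ≤ f * k := Nat.le_mul_of_pos_right f hk
        have := uniq hq (hfB (by omega)) (hlt (f - r) (by omega)) hn (by omega)
        omega
  refine ⟨fun h => absurd h hnB, fun hn => ?_, fun hk => ?_⟩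
  · have hnN := bound hn hB
    obtain ⟨q, hq, b, hb, hab⟩ := split (by omega)
    rcases Nat.lt_or_ge (f * q) (f * k) with hlt' | hge
    · have := uniq ((shift _ ⟨q, rfl⟩ hlt').mp hq) hb hn hB (by omega)
      omega
    · rwa [show f * q = f * k by omega] at hq
  · rcases Nat.eq_zero_or_pos k with rfl | hk0
    · simpa using hlt r hr
    · have hfk : f ≤ f * k := Nat.le_mul_of_pos_right f hk0
      have hkN := bound hk hB
      have hnN := bound hk (hfB (by omega))
      -- If `a` and `b` are both positive, induction makes `b` a multiple of `f` and puts `a - r`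
      -- into `A`; then `(a - r) + b = f * k + 0` forces `b = 0`.
      obtain ⟨a, ha, b, hb, hab⟩ := exist (show f * k + r < N by omega)
      rcases Nat.eq_zero_or_pos a with rfl | ha0
      · rw [zero_add] at hab; exact absurd (hab ▸ hb) hnB
      rcases Nat.eq_zero_or_pos b with rfl | hb0
      · rwa [← hab]
      obtain ⟨q, rfl⟩ := (ih b (by omega)).1 hb
      have h1 := (ih a (by omega)).2.mp ha
      have h2 : a % f = r := by
        have := congrArg (· % f) hab
        simpa [Nat.mod_eq_of_lt hr] using this
      have h3 := Nat.div_add_mod a f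
      have := uniq h1 hb hk hB (by omega)
      omega

variable {m N : ℕ} {A : Fin m → Finset ℕ}

theorem IsSumSystem.exists_sum_eq (h : IsSumSystem N A) {x : ℕ} (hx : x < N) :
    ∃ g : Fin m → ℕ, (∀ i, g i ∈ A i) ∧ ∑ i, g i = x := by
  rw [← Finset.mem_range, ← h.2, ← Finset.mem_coe, Finset.coe_sum, Set.mem_fintype_sum] at hx
  simpa using hx

theorem IsSumSystem.zero_mem (h : IsSumSystem N A) (hN : 0 < N) (i : Fin m) : 0 ∈ A i := by
  obtain ⟨g, hg, h0⟩ := h.exists_sum_eq hN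
  rw [Finset.sum_eq_zero_iff] at h0
  simpa [h0 i (Finset.mem_univ i)] using hg i

theorem IsSumSystem.exists_one_mem (h : IsSumSystem N A) (hN : 1 < N) : ∃ j, 1 ∈ A j := by
  obtain ⟨g, hg, h1⟩ := h.exists_sum_eq hN
  obtain ⟨j, -, hj⟩ := Finset.exists_ne_zero_of_sum_ne_zero (show ∑ i, g i ≠ 0 by omega)
  have := Finset.single_le_sum (f := g) (fun _ _ => Nat.zero_le _) (Finset.mem_univ j)
  exact ⟨j, by simpa [show g j = 1 by omega] using hg j⟩

theorem card_sum_le_prod_card {ι : Type*} (s : Finset ι) (A : ι → Finset ℕ) :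
    (∑ i ∈ s, A i).card ≤ ∏ i ∈ s, (A i).card := by
  classical
  induction s using Finset.induction_on with
  | empty => simp
  | insert a s ha ih =>
    rw [Finset.sum_insert ha, Finset.prod_insert ha]
    exact Finset.card_add_le.trans (Nat.mul_le_mul_left _ ih)

/-- The full sumset has as many elements as the product of the cardinalities, so no sum can be
attained twice. -/
theorem IsSumSystem.injOn_add (h : IsSumSystem N A) (j : Fin m) :
    ((A j) ×ˢ (∑ i ∈ Finset.univ.erase j, A i : Finset ℕ) : Set (ℕ × ℕ)).InjOn
      fun p => p.1 + p.2 := by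
  rw [← Finset.card_add_iff]
  refine le_antisymm Finset.card_add_le ?_
  rw [Finset.add_sum_erase _ _ (Finset.mem_univ j), h.2, Finset.card_range, ← h.1,
    ← Finset.mul_prod_erase _ _ (Finset.mem_univ j)]
  exact Nat.mul_le_mul_left _ (card_sum_le_prod_card _ _)

/-- De Bruijn's decomposition: a sum system for `N ≥ 2` is an inflation of a smaller one. -/
theorem IsSumSystem.exists_eq_inflate (h : IsSumSystem N A) (hN : 1 < N) :
    ∃ (j : Fin m) (f d : ℕ) (B : Fin m → Finset ℕ), 2 ≤ f ∧ N = f * d ∧ IsSumSystem d B ∧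
      1 ∉ B j ∧ A = inflate j f B := by
  have h0 := h.zero_mem (by omega)
  obtain ⟨j, hj⟩ := h.exists_one_mem hN
  have hex : ∃ f, f ∉ A j := Infinite.exists_notMem_finset (A j)
  classical
  let f := Nat.find hex
  have hfA : f ∉ A j := Nat.find_spec hex
  have hlt : ∀ r < f, r ∈ A j := fun r hr => not_not.mp (Nat.find_min hex hr)
  have hf2 : 2 ≤ f := by
    have h1 : f ≠ 0 := fun e => hfA (e ▸ h0 j)
    have h2 : f ≠ 1 := fun e => hfA (e ▸ hj)
    omega
  have hf0 : 0 < f := by omega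
  -- All parts contain `0`, so divisibility by `f` for the complementary sumset passes to each
  -- single part.
  have hmem : ∀ i ≠ j, ∀ x ∈ A i, x ∈ ∑ i ∈ Finset.univ.erase j, A i := by
    intro i hi x hx
    rw [← Finset.add_sum_erase _ _ (Finset.mem_erase.mpr ⟨hi, Finset.mem_univ i⟩),
      ← add_zero x]
    refine Finset.add_mem_add hx ?_
    rw [← Finset.mem_coe, Finset.coe_sum, ← Finset.sum_const_zero (ι := Fin m)]
    exact Set.finsetSum_mem_finsetSum _ _ _ fun i _ => h0 i
  have h0' : 0 ∈ ∑ i ∈ Finset.univ.erase j, A i := by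
    rw [← Finset.mem_coe, Finset.coe_sum, ← Finset.sum_const_zero (ι := Fin m)]
    exact Set.finsetSum_mem_finsetSum _ _ _ fun i _ => h0 i
  have key := dvd_and_mem_iff_of_add_eq_range
    ((Finset.add_sum_erase _ _ (Finset.mem_univ j)).trans h.2) (h.injOn_add j) h0' hf0 hlt hfA
  -- Rounding down treats both kinds of part alike: it collapses the blocks of part `j` and is exact
  -- division on the others.
  let B : Fin m → Finset ℕ := fun i => (A i).image (· / f)
  have hB : ∀ i x, x ∈ B i ↔ f * x ∈ A i := by
    intro i x
    simp only [B, Finset.mem_image]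
    constructor
    · rintro ⟨y, hy, rfl⟩
      by_cases hi : i = j
      · subst hi; exact (key y).2.mp hy
      · rwa [Nat.mul_div_cancel' ((key y).1 (hmem i hi y hy))]
    · exact fun hx => ⟨_, hx, Nat.mul_div_cancel_left _ hf0⟩
  have hA : A = inflate j f B := by
    funext i
    ext x
    rw [mem_inflate hf0, hB]
    by_cases hi : i = j
    · subst hi; simpa using (key x).2
    · simp only [hi, false_or]
      constructor
      · intro hx
        have hd := (key x).1 (hmem i hi x hx)
        exact ⟨by rwa [Nat.mul_div_cancel' hd], hd⟩
      · rintro ⟨hx, hd⟩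
        rwa [Nat.mul_div_cancel' hd] at hx
  have hdvd : f ∣ N := by
    rw [← h.1, hA]
    refine Dvd.dvd.trans ?_ (Finset.dvd_prod_of_mem _ (Finset.mem_univ j))
    rw [card_inflate hf0, if_pos rfl]
    exact dvd_mul_right _ _
  obtain ⟨d, rfl⟩ := hdvd
  refine ⟨j, f, d, B, hf2, rfl, ?_, ?_, hA⟩
  · rwa [hA, isSumSystem_inflate_iff hf0] at h
  · rwa [hB, mul_one]

end Tiling

/-! ### Sum systems and factor chains -/

section Chains

/-- A list of pairs of an index and a factor at least two, consecutive indices being distinct. -/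
def IsFactorChain {α : Type*} (l : List (α × ℕ)) : Prop :=
  (∀ p ∈ l, 2 ≤ p.2) ∧ l.IsChain fun p q => p.1 ≠ q.1

variable {α : Type*}

theorem isFactorChain_nil : IsFactorChain ([] : List (α × ℕ)) := by
  simp [IsFactorChain]

theorem isFactorChain_cons {j : α} {f : ℕ} {l : List (α × ℕ)} :
    IsFactorChain ((j, f) :: l) ↔ 2 ≤ f ∧ (∀ p ∈ l.head?, j ≠ p.1) ∧ IsFactorChain l := by
  simp only [IsFactorChain, List.forall_mem_cons, List.isChain_cons]
  tauto

/-- The sum system built from a factor chain by successive inflations. -/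
def systemOfChain [DecidableEq α] : List (α × ℕ) → α → Finset ℕ
  | [] => 0
  | p :: l => inflate p.1 p.2 (systemOfChain l)

variable [DecidableEq α]

theorem mem_systemOfChain_cons {j : α} {f : ℕ} (hf : 0 < f) {l : List (α × ℕ)} {i : α} {x : ℕ} :
    x ∈ systemOfChain ((j, f) :: l) i ↔ x / f ∈ systemOfChain l i ∧ (i = j ∨ f ∣ x) :=
  mem_inflate hf

theorem zero_mem_systemOfChain {l : List (α × ℕ)} (h : IsFactorChain l) (i : α) :
    0 ∈ systemOfChain l i := by
  induction l with
  | nil => simp [systemOfChain]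
  | cons p l ih =>
    obtain ⟨j, f⟩ := p
    rw [isFactorChain_cons] at h
    simp [mem_systemOfChain_cons (show 0 < f by omega), ih h.2.2]

theorem mem_systemOfChain_cons_of_lt {j : α} {f : ℕ} {l : List (α × ℕ)}
    (h : IsFactorChain ((j, f) :: l)) {i : α} {x : ℕ} (hx0 : 0 < x) (hx : x < f) :
    x ∈ systemOfChain ((j, f) :: l) i ↔ i = j := by
  have hf : ¬ f ∣ x := fun hd => absurd (Nat.le_of_dvd hx0 hd) (by omega)
  simp [mem_systemOfChain_cons (show 0 < f by omega), Nat.div_eq_of_lt hx, hf,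
    zero_mem_systemOfChain (isFactorChain_cons.mp h).2.2]

theorem one_mem_systemOfChain_iff {l : List (α × ℕ)} (h : IsFactorChain l) (i : α) :
    1 ∈ systemOfChain l i ↔ ∃ p ∈ l.head?, i = p.1 := by
  cases l with
  | nil => simp [systemOfChain]
  | cons p l =>
    obtain ⟨j, f⟩ := p
    rw [mem_systemOfChain_cons_of_lt h one_pos (isFactorChain_cons.mp h).1]
    simp

/-- Here distinctness of consecutive indices enters: `f` would come from a `1` in part `j` of the
tail, but `1` lies only in the tail's leading part. Hence `f` is the first number missing from part
`j`. -/
theorem notMem_systemOfChain_cons_self {j : α} {f : ℕ} {l : List (α × ℕ)}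
    (h : IsFactorChain ((j, f) :: l)) : f ∉ systemOfChain ((j, f) :: l) j := by
  obtain ⟨hf, hl, hc⟩ := isFactorChain_cons.mp h
  rw [mem_systemOfChain_cons (by omega), Nat.div_self (by omega),
    one_mem_systemOfChain_iff hc]
  rintro ⟨⟨p, hp, e⟩, -⟩
  exact hl p hp e

/-- The first index is the part containing `1`, the first factor is the first number missing from
it, and the multiples of that factor recover the tail's system. -/
theorem systemOfChain_injOn :
    Set.InjOn (systemOfChain (α := α)) {l | IsFactorChain l} := by
  intro l hl l' hl' e
  induction l generalizing l' with
  | nil =>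
    cases l' with
    | nil => rfl
    | cons p' l' =>
      have h := (one_mem_systemOfChain_iff hl' p'.1).mpr (by simp)
      rw [← e, one_mem_systemOfChain_iff hl] at h
      simp at h
  | cons p l ih =>
    cases l' with
    | nil =>
      have h := (one_mem_systemOfChain_iff hl p.1).mpr (by simp)
      rw [e, one_mem_systemOfChain_iff hl'] at h
      simp at h
    | cons p' l' =>
      obtain ⟨j, f⟩ := p
      obtain ⟨j', f'⟩ := p'
      obtain ⟨hf, -, hc⟩ := isFactorChain_cons.mp hl
      obtain ⟨hf', -, hc'⟩ := isFactorChain_cons.mp hl'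
      have hj : j = j' := by
        have h := (one_mem_systemOfChain_iff hl j).mpr (by simp)
        rw [e, one_mem_systemOfChain_iff hl'] at h
        simpa using h
      subst hj
      have hff : f = f' := by
        rcases lt_trichotomy f f' with h | h | h
        · refine absurd ?_ (notMem_systemOfChain_cons_self hl)
          rw [e]
          exact (mem_systemOfChain_cons_of_lt hl' (by omega) h).mpr rfl
        · exact h
        · refine absurd ?_ (notMem_systemOfChain_cons_self hl')
          rw [← e]
          exact (mem_systemOfChain_cons_of_lt hl (by omega) h).mpr rfl
      subst hff
      rw [ih hc hc']
      funext i
      ext x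
      have h := congrArg (f * x ∈ · i) e
      have hf0 : 0 < f := by omega
      simpa [mem_systemOfChain_cons hf0, Nat.mul_div_cancel_left _ hf0] using h

/-- At most one of the two parts receives the block at each inflation, so a common element is
divisible by every factor in turn and descends to the trivial system. -/
theorem eq_zero_of_mem_systemOfChain {l : List (α × ℕ)} (h : IsFactorChain l) {i j : α}
    (hij : i ≠ j) {x : ℕ} (hi : x ∈ systemOfChain l i) (hj : x ∈ systemOfChain l j) : x = 0 := by
  induction l generalizing x with
  | nil => simpa [systemOfChain] using hi
  | cons p l ih =>
    obtain ⟨k, f⟩ := p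
    obtain ⟨hf, -, hc⟩ := isFactorChain_cons.mp h
    rw [mem_systemOfChain_cons (by omega)] at hi hj
    have hx := ih hc hi.1 hj.1
    have hd : f ∣ x := by
      rcases hi.2 with rfl | hd
      · exact hj.2.resolve_left hij.symm
      · exact hd
    rw [← Nat.div_mul_cancel hd, hx, zero_mul]

theorem card_systemOfChain {l : List (α × ℕ)} (h : IsFactorChain l) (i : α) :
    (systemOfChain l i).card = ((l.filter fun p => p.1 = i).map Prod.snd).prod := by
  induction l with
  | nil => simp [systemOfChain]
  | cons p l ih =>
    obtain ⟨j, f⟩ := p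
    obtain ⟨hf, -, hc⟩ := isFactorChain_cons.mp h
    rw [systemOfChain, card_inflate (by simp only; omega), ih hc, List.filter_cons]
    by_cases hij : j = i
    · simp [hij]
    · simp [hij, Ne.symm hij]

theorem prod_prod_filter [Fintype α] (l : List (α × ℕ)) :
    ∏ i, ((l.filter fun p => p.1 = i).map Prod.snd).prod = (l.map Prod.snd).prod := by
  induction l with
  | nil => simp
  | cons p l ih =>
    have h1 : p.2 = ∏ i, if p.1 = i then p.2 else 1 := by simp
    rw [List.map_cons, List.prod_cons, ← ih, h1, ← Finset.prod_mul_distrib]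
    refine Finset.prod_congr rfl fun i _ => ?_
    by_cases h : p.1 = i <;> simp [h]

theorem two_le_prod_filter_iff {l : List (α × ℕ)} (h : ∀ p ∈ l, 2 ≤ p.2) (i : α) :
    2 ≤ ((l.filter fun p => p.1 = i).map Prod.snd).prod ↔ i ∈ (l.map Prod.fst).toFinset := by
  induction l with
  | nil => simp
  | cons p l ih =>
    rw [List.forall_mem_cons] at h
    by_cases hp : p.1 = i
    · have hpos : 0 < ((l.filter fun p => p.1 = i).map Prod.snd).prod := by
        refine List.prod_pos fun a ha => ?_
        obtain ⟨q, hq, rfl⟩ := List.mem_map.mp ha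
        have := h.2 q (List.mem_of_mem_filter hq)
        omega
      simp only [hp, decide_true, List.filter_cons_of_pos, List.map_cons, List.prod_cons,
        List.toFinset_cons, Finset.mem_insert, true_or, iff_true]
      exact h.1.trans (Nat.le_mul_of_pos_right _ hpos)
    · simp [hp, Ne.symm hp, ih h.2]

theorem isSumSystem_systemOfChain {m : ℕ} {l : List (Fin m × ℕ)} (h : IsFactorChain l) :
    IsSumSystem (l.map Prod.snd).prod (systemOfChain l) := by
  induction l with
  | nil =>
    refine ⟨by simp [systemOfChain], ?_⟩
    simp only [systemOfChain, Pi.zero_apply, Finset.sum_const_zero]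
    rfl
  | cons p l ih =>
    obtain ⟨hf, -, hc⟩ := isFactorChain_cons.mp h
    rw [List.map_cons, List.prod_cons, systemOfChain, isSumSystem_inflate_iff (by omega)]
    exact ih hc

theorem IsSumSystem.exists_systemOfChain {m N : ℕ} {A : Fin m → Finset ℕ} (h : IsSumSystem N A)
    (hN : 0 < N) : ∃ l, IsFactorChain l ∧ systemOfChain l = A := by
  induction N using Nat.strong_induction_on generalizing A with
  | _ N ih =>
  rcases Nat.lt_or_ge 1 N with hN1 | hN1
  · obtain ⟨j, f, d, B, hf, rfl, hB, h1, rfl⟩ := h.exists_eq_inflate hN1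
    have hd : 0 < d := Nat.pos_of_mul_pos_left hN
    obtain ⟨l, hl, rfl⟩ := ih d (by nlinarith) hB hd
    refine ⟨(j, f) :: l, isFactorChain_cons.mpr ⟨hf, fun p hp e => h1 ?_, hl⟩, rfl⟩
    exact (one_mem_systemOfChain_iff hl j).mpr ⟨p, hp, e⟩
  · obtain rfl : N = 1 := by omega
    refine ⟨[], isFactorChain_nil, ?_⟩
    funext i
    have hc := h.1
    rw [Finset.prod_eq_one_iff] at hc
    obtain ⟨a, ha⟩ := Finset.card_eq_one.mp (hc i (Finset.mem_univ i))
    have h0 := h.zero_mem hN i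
    rw [ha, Finset.mem_singleton] at h0
    rw [ha, ← h0]
    rfl

/-- The factor chains with total product `N` in which exactly the indices in `S` occur. -/
def factorChains (S : Finset α) (N : ℕ) : Set (List (α × ℕ)) :=
  {l | IsFactorChain l ∧ (l.map Prod.snd).prod = N ∧ (l.map Prod.fst).toFinset = S}

/-- The tuple `n` is determined by the chain, and `2 ≤ n j` means just that the index `j` occurs. -/
theorem jointOrderedFactorisations_eq (m N : ℕ) :
    jointOrderedFactorisations m N = factorChains Finset.univ N := by
  ext l
  simp only [jointOrderedFactorisations, IsJointOrderedFactorisation, factorChains,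
    Set.mem_ofPred_eq, Finset.eq_univ_iff_forall, ← prod_prod_filter l]
  constructor
  · rintro ⟨n, hn, hN, h2, hc, hprod⟩
    simp_rw [hprod]
    exact ⟨⟨h2, hc⟩, hN, fun i => (two_le_prod_filter_iff h2 i).mp (by rw [hprod]; exact hn i)⟩
  · rintro ⟨⟨h2, hc⟩, hN, hS⟩
    exact ⟨_, fun i => (two_le_prod_filter_iff h2 i).mpr (hS i), hN, h2, hc, fun _ => rfl⟩

theorem image_systemOfChain (m : ℕ) {N : ℕ} (hN : 0 < N) :
    systemOfChain '' factorChains (Finset.univ : Finset (Fin m)) N = sumSystems m N := by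
  ext A
  constructor
  · rintro ⟨l, ⟨hl, rfl, hS⟩, rfl⟩
    refine ⟨isSumSystem_systemOfChain hl, fun j => ?_⟩
    rw [card_systemOfChain hl, two_le_prod_filter_iff hl.1, hS]
    exact Finset.mem_univ j
  · rintro ⟨hA, hc⟩
    obtain ⟨l, hl, rfl⟩ := hA.exists_systemOfChain hN
    refine ⟨l, ⟨hl, ?_, ?_⟩, rfl⟩
    · rw [← hA.1, ← prod_prod_filter]
      exact Finset.prod_congr rfl fun i _ => (card_systemOfChain hl i).symm
    · refine Finset.eq_univ_iff_forall.mpr fun i => ?_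
      rw [← two_le_prod_filter_iff hl.1, ← card_systemOfChain hl]
      exact hc i

theorem ncard_factorChains_univ (m : ℕ) {N : ℕ} (hN : 0 < N) :
    (factorChains (Finset.univ : Finset (Fin m)) N).ncard = numSumSystems m N := by
  rw [numSumSystems, ← image_systemOfChain m hN,
    Set.InjOn.ncard_image (systemOfChain_injOn.mono fun _ h => h.1)]

end Chains

/-! ### Counting chains by their first factor -/

section Recurrence

variable {α : Type*} [DecidableEq α]

theorem factorChains_empty (N : ℕ) :
    factorChains (∅ : Finset α) N = {l | l = [] ∧ N = 1} := by
  ext l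
  simp only [factorChains, Set.mem_ofPred_eq, List.toFinset_eq_empty_iff, List.map_eq_nil_iff]
  constructor
  · rintro ⟨-, h, rfl⟩
    exact ⟨rfl, by simpa using h.symm⟩
  · rintro ⟨rfl, rfl⟩
    exact ⟨isFactorChain_nil, by simp, rfl⟩

/-- Whether `j` recurs in the tail decides between the index sets `S` and `S.erase j`; these are the
two terms of the recurrence. -/
theorem cons_mem_factorChains {j : α} {f N : ℕ} {l : List (α × ℕ)} {S : Finset α} :
    (j, f) :: l ∈ factorChains S N ↔ 2 ≤ f ∧ (∀ p ∈ l.head?, j ≠ p.1) ∧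
      f * (l.map Prod.snd).prod = N ∧ j ∈ S ∧
      l ∈ factorChains S (l.map Prod.snd).prod ∪ factorChains (S.erase j) (l.map Prod.snd).prod := by
  simp only [factorChains, Set.mem_ofPred_eq, isFactorChain_cons, List.map_cons, List.prod_cons,
    List.toFinset_cons, Set.mem_union, true_and]
  generalize (l.map Prod.fst).toFinset = T
  have : insert j T = S ↔ j ∈ S ∧ (T = S ∨ T = S.erase j) := by
    constructor
    · rintro rfl
      refine ⟨Finset.mem_insert_self _ _, ?_⟩
      by_cases h : j ∈ T
      · simp [h]
      · simp [h]
    · rintro ⟨h, rfl | rfl⟩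
      · simpa using h
      · exact Finset.insert_erase h
  rw [this]
  tauto

theorem pos_of_mem_factorChains {S : Finset α} {N : ℕ} {l : List (α × ℕ)}
    (h : l ∈ factorChains S N) : 0 < N := by
  rw [← h.2.1]
  refine List.prod_pos fun a ha => ?_
  obtain ⟨q, hq, rfl⟩ := List.mem_map.mp ha
  have := h.1.1 q hq
  omega

/-- The possible tails, with product `d`, of the factor chains that start with the index `j`. -/
def factorTails (S : Finset α) (j : α) (d : ℕ) : Set (List (α × ℕ)) :=
  {l ∈ factorChains S d | ∀ p ∈ l.head?, j ≠ p.1} ∪ factorChains (S.erase j) d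

theorem head_ne_of_mem_factorChains_erase {S : Finset α} {j : α} {d : ℕ} {l : List (α × ℕ)}
    (h : l ∈ factorChains (S.erase j) d) : ∀ p ∈ l.head?, j ≠ p.1 := by
  rintro p hp rfl
  have h1 : p.1 ∈ (l.map Prod.fst).toFinset := by
    rw [List.mem_toFinset]
    exact List.mem_map_of_mem (List.mem_of_mem_head? hp)
  rw [h.2.2] at h1
  simp at h1

theorem factorChains_eq_biUnion {S : Finset α} (hS : S.Nonempty) {N : ℕ} :
    factorChains S N = ⋃ x ∈ S ×ˢ N.properDivisors,
      List.cons (x.1, N / x.2) '' factorTails S x.1 x.2 := by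
  ext l
  simp only [Set.mem_iUnion, Finset.mem_product, Nat.mem_properDivisors, Set.mem_image]
  constructor
  · intro h
    cases l with
    | nil =>
      obtain ⟨-, -, h⟩ := h
      exact absurd h.symm hS.ne_empty
    | cons p l =>
      obtain ⟨j, f⟩ := p
      obtain ⟨hf, hh, rfl, hj, hl⟩ := cons_mem_factorChains.mp h
      have hpos : 0 < (l.map Prod.snd).prod := hl.elim pos_of_mem_factorChains
        pos_of_mem_factorChains
      refine ⟨(j, (l.map Prod.snd).prod), ⟨hj, dvd_mul_left _ _, by nlinarith⟩, l, ?_, ?_⟩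
      · exact hl.imp (fun h => ⟨h, hh⟩) id
      · simp [Nat.mul_div_cancel _ hpos]
  · rintro ⟨⟨j, d⟩, ⟨hj, ⟨f, rfl⟩, hlt⟩, l, hl, rfl⟩
    have hd : (l.map Prod.snd).prod = d := hl.elim (fun h => h.1.2.1) fun h => h.2.1
    have hpos : 0 < d := hl.elim (fun h => pos_of_mem_factorChains h.1) pos_of_mem_factorChains
    have hf : 2 ≤ f := by
      by_contra hf
      have : d * f ≤ d * 1 := Nat.mul_le_mul_left _ (by omega)
      simp only at hlt
      omega
    rw [Nat.mul_div_cancel_left _ hpos, cons_mem_factorChains, hd]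
    refine ⟨hf, ?_, mul_comm _ _, hj, hl.imp (fun h => h.1) id⟩
    exact hl.elim (fun h => h.2) head_ne_of_mem_factorChains_erase

theorem factorChains_finite (S : Finset α) (N : ℕ) : (factorChains S N).Finite := by
  induction N using Nat.strong_induction_on generalizing S with
  | _ N ih =>
  rcases S.eq_empty_or_nonempty with rfl | hS
  · rw [factorChains_empty]
    exact (Set.finite_singleton []).subset fun l hl => hl.1
  · rw [factorChains_eq_biUnion hS]
    refine Set.Finite.biUnion (Finset.finite_toSet _) fun x hx => Set.Finite.image _ ?_
    simp only [Finset.coe_product, Set.mem_prod, Finset.mem_coe, Nat.mem_properDivisors] at hx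
    exact ((ih _ hx.2.2 S).subset fun l hl => hl.1).union (ih _ hx.2.2 _)

theorem factorTails_finite (S : Finset α) (j : α) (d : ℕ) : (factorTails S j d).Finite :=
  ((factorChains_finite S d).subset fun _ hl => hl.1).union (factorChains_finite _ d)

theorem ncard_factorTails {S : Finset α} {j : α} (hj : j ∈ S) (d : ℕ) :
    (factorTails S j d).ncard =
      {l ∈ factorChains S d | ∀ p ∈ l.head?, j ≠ p.1}.ncard + (factorChains (S.erase j) d).ncard := by
  refine Set.ncard_union_eq ?_ ((factorChains_finite S d).subset fun _ hl => hl.1)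
    (factorChains_finite _ d)
  rw [Set.disjoint_left]
  rintro l ⟨h, -⟩ h'
  have := h.2.2.symm.trans h'.2.2
  rw [this] at hj
  simp at hj

/-- Double counting: each chain is nonempty and is excluded for exactly one `j`, its first index. -/
theorem sum_ncard_head_ne (S : Finset α) (hS : S.Nonempty) (d : ℕ) :
    ∑ j ∈ S, {l ∈ factorChains S d | ∀ p ∈ l.head?, j ≠ p.1}.ncard =
      (S.card - 1) * (factorChains S d).ncard := by
  classical
  have hfin := factorChains_finite S d
  have h1 : ∀ j ∈ S, {l ∈ factorChains S d | ∀ p ∈ l.head?, j ≠ p.1}.ncard =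
      (hfin.toFinset.filter fun l => ∀ p ∈ l.head?, j ≠ p.1).card := by
    intro j _
    rw [← Set.ncard_coe_finset]
    congr 1
    ext l
    simp
  rw [Finset.sum_congr rfl h1, Set.ncard_eq_toFinset_card _ hfin]
  have := Finset.sum_card_bipartiteAbove_eq_sum_card_bipartiteBelow (s := S) (t := hfin.toFinset)
    fun j l => ∀ p ∈ l.head?, j ≠ p.1
  simp only [Finset.bipartiteAbove, Finset.bipartiteBelow] at this
  rw [this, Finset.sum_const_nat, mul_comm]
  intro l hl
  rw [Set.Finite.mem_toFinset] at hl
  obtain ⟨-, -, h⟩ := hl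
  cases l with
  | nil => exact absurd h.symm hS.ne_empty
  | cons p l =>
    have hp : p.1 ∈ S := by rw [← h]; simp
    rw [← Finset.card_erase_of_mem hp, Finset.erase_eq]
    congr 1
    ext j
    simp

theorem ncard_factorChains {S : Finset α} (hS : S.Nonempty) (N : ℕ) :
    (factorChains S N).ncard = ∑ d ∈ N.properDivisors,
      ((S.card - 1) * (factorChains S d).ncard + ∑ j ∈ S, (factorChains (S.erase j) d).ncard) := by
  -- A chain determines `j` as its first index and `d` as the product of its tail.
  have hdisj : ((S ×ˢ N.properDivisors : Finset (α × ℕ)) : Set (α × ℕ)).PairwiseDisjoint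
      fun x => List.cons (x.1, N / x.2) '' factorTails S x.1 x.2 := by
    rintro ⟨j, d⟩ - ⟨j', d'⟩ - hne
    rw [Function.onFun, Set.disjoint_left]
    rintro _ ⟨l, hl, rfl⟩ ⟨l', hl', e⟩
    simp only [List.cons.injEq, Prod.mk.injEq] at e
    obtain ⟨⟨rfl, -⟩, rfl⟩ := e
    have hd : (l'.map Prod.snd).prod = d := hl.elim (fun h => h.1.2.1) fun h => h.2.1
    have hd' : (l'.map Prod.snd).prod = d' := hl'.elim (fun h => h.1.2.1) fun h => h.2.1
    exact hne (by rw [← hd, ← hd'])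
  have h := Set.Finite.ncard_biUnion (Finset.finite_toSet (S ×ˢ N.properDivisors))
    (fun x _ => (factorTails_finite S x.1 x.2).image (List.cons (x.1, N / x.2))) hdisj
  simp only [Finset.mem_coe] at h
  rw [factorChains_eq_biUnion hS, h, finsum_mem_finset_eq_sum, Finset.sum_product_right]
  refine Finset.sum_congr rfl fun d _ => ?_
  rw [← sum_ncard_head_ne S hS, ← Finset.sum_add_distrib]
  refine Finset.sum_congr rfl fun j hj => ?_
  rw [Set.ncard_image_of_injective _ List.cons_injective, ncard_factorTails hj]

/-- The recurrence sees only the size of the index set. This identifies the count for `Fin m`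
without `j` with that for `Fin (m - 1)`. -/
theorem ncard_factorChains_congr {β : Type*} [DecidableEq β] (S : Finset α) (T : Finset β)
    (h : S.card = T.card) (N : ℕ) : (factorChains S N).ncard = (factorChains T N).ncard := by
  induction N using Nat.strong_induction_on generalizing S T with
  | _ N ih =>
  rcases S.eq_empty_or_nonempty with rfl | hS
  · obtain rfl : T = ∅ := by simpa using h.symm
    simp only [factorChains_empty]
    by_cases hN : N = 1 <;> simp [hN]
  · have hT : T.Nonempty := by rwa [← Finset.card_pos, ← h, Finset.card_pos]
    rw [ncard_factorChains hS, ncard_factorChains hT]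
    refine Finset.sum_congr rfl fun d hd => ?_
    have hlt := (Nat.mem_properDivisors.mp hd).2
    rw [h, ih d hlt S T h]
    congr 1
    obtain ⟨t, ht⟩ := hT
    have h1 : ∀ j ∈ S, (factorChains (S.erase j) d).ncard = (factorChains (T.erase t) d).ncard :=
      fun j hj => ih d hlt _ _ (by rw [Finset.card_erase_of_mem hj, Finset.card_erase_of_mem ht, h])
    have h2 : ∀ j ∈ T, (factorChains (T.erase j) d).ncard = (factorChains (T.erase t) d).ncard := by
      intro j hj
      rw [← h1 _ hS.choose_spec]
      refine (ih d hlt _ _ ?_).symm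
      rw [Finset.card_erase_of_mem hj, Finset.card_erase_of_mem hS.choose_spec, h]
    rw [Finset.sum_const_nat h1, Finset.sum_const_nat h2, h]

theorem numSumSystems_eq_sum {m N : ℕ} (hm : 1 ≤ m) (hN : 0 < N) :
    numSumSystems m N = ∑ d ∈ N.properDivisors,
      ((m - 1) * numSumSystems m d + m * numSumSystems (m - 1) d) := by
  have hne : (Finset.univ : Finset (Fin m)).Nonempty := ⟨⟨0, hm⟩, Finset.mem_univ _⟩
  rw [← ncard_factorChains_univ m hN, ncard_factorChains hne]
  refine Finset.sum_congr rfl fun d hd => ?_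
  have hd0 : 0 < d := Nat.pos_of_dvd_of_pos (Nat.mem_properDivisors.mp hd).1 hN
  have h1 : ∀ j ∈ (Finset.univ : Finset (Fin m)),
      (factorChains (Finset.univ.erase j) d).ncard = numSumSystems (m - 1) d := by
    intro j hj
    rw [← ncard_factorChains_univ (m - 1) hd0]
    exact ncard_factorChains_congr _ _ (by simp [Finset.card_erase_of_mem hj]) d
  rw [Finset.sum_const_nat h1, ncard_factorChains_univ m hd0, Finset.card_univ, Fintype.card_fin]

end Recurrence

/-! ### Möbius inversion -/

section Moebius

open ArithmeticFunction in
/-- Moebius inversion of `a N = ∑_{d ∣ N, d < N} ((m - 1) a d + m b d)`. -/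
theorem eq_neg_mul_sum_moebius {m : ℤ} {a b : ℕ → ℤ}
    (h : ∀ n > 0, a n = ∑ d ∈ n.properDivisors, ((m - 1) * a d + m * b d)) {N : ℕ} (hN : 0 < N) :
    a N = -m * ∑ d ∈ N.properDivisors, moebius (N / d) * (a d + b d) := by
  -- Adding the term `d = n` to the recurrence turns it into a full divisor sum, ready for
  -- inversion.
  have hg : ∀ n > 0, ∑ d ∈ n.divisors, ((m - 1) * a d + m * b d) = m * (a n + b n) := by
    intro n hn
    rw [← Nat.cons_self_properDivisors hn.ne', Finset.sum_cons, ← h n hn]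
    ring
  have hinv := sum_eq_iff_sum_mul_moebius_eq.mp hg N hN
  simp only [Int.cast_id] at hinv
  rw [Nat.sum_divisorsAntidiagonal' fun x y => moebius x * (m * (a y + b y)),
    ← Nat.cons_self_properDivisors hN.ne', Finset.sum_cons, Nat.div_self hN, moebius_apply_one]
    at hinv
  have hs : ∑ d ∈ N.properDivisors, moebius (N / d) * (m * (a d + b d)) =
      m * ∑ d ∈ N.properDivisors, moebius (N / d) * (a d + b d) := by
    rw [Finset.mul_sum]
    exact Finset.sum_congr rfl fun d _ => by ring
  rw [hs] at hinv
  linarith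

end Moebius

/-! ### Tuples up to permutation -/

section Unordered

variable {α : Type*} {m : ℕ}

theorem exists_perm_of_map_univ_eq {A B : Fin m → α} (hA : A.Injective) (hB : B.Injective)
    (h : (Finset.univ : Finset (Fin m)).val.map A = (Finset.univ : Finset (Fin m)).val.map B) :
    ∃ σ : Equiv.Perm (Fin m), A ∘ σ = B := by
  have hr : Set.range B = Set.range A := by
    ext x
    have := congrArg (x ∈ ·) h
    simpa using this.symm
  refine ⟨(Equiv.ofInjective B hB).trans
    ((Equiv.setCongr hr).trans (Equiv.ofInjective A hA).symm), ?_⟩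
  funext i
  simp [Equiv.apply_ofInjective_symm]

/-- A family of tuples with distinct entries that is closed under permutations has `m!` times as
many members as there are members up to permutation. -/
theorem ncard_unordered_mul_factorial {S : Set (Fin m → α)} (hS : S.Finite)
    (hinj : ∀ A ∈ S, A.Injective) (hperm : ∀ A ∈ S, ∀ σ : Equiv.Perm (Fin m), A ∘ σ ∈ S) :
    (unordered S).ncard * m.factorial = S.ncard := by
  classical
  let F : (Fin m → α) → Multiset α := fun A => (Finset.univ : Finset (Fin m)).val.map A
  have hU : unordered S = ((hS.toFinset.image F : Finset (Multiset α)) : Set (Multiset α)) := by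
    simp [unordered, F]
  rw [hU, Set.ncard_coe_finset, Set.ncard_eq_toFinset_card S hS]
  rw [Finset.card_eq_sum_card_image F, Finset.sum_const_nat]
  intro M hM
  obtain ⟨A, hA, rfl⟩ := Finset.mem_image.mp hM
  rw [Set.Finite.mem_toFinset] at hA
  -- The fibre over a multiset is one orbit of the permutations, free because `A` is injective.
  have hfib : hS.toFinset.filter (fun B => F B = F A) =
      (Finset.univ : Finset (Equiv.Perm (Fin m))).image
        fun σ : Equiv.Perm (Fin m) => A ∘ σ := by
    ext B
    simp only [Finset.mem_filter, Set.Finite.mem_toFinset, Finset.mem_image, Finset.mem_univ,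
      true_and]
    constructor
    · rintro ⟨hB, h⟩
      exact exists_perm_of_map_univ_eq (hinj A hA) (hinj B hB) h.symm
    · rintro ⟨σ, rfl⟩
      refine ⟨hperm A hA σ, ?_⟩
      simp only [F]
      rw [← Multiset.map_map, Multiset.map_univ_val_equiv]
  rw [hfib, Finset.card_image_of_injective, Finset.card_univ, Fintype.card_perm,
    Fintype.card_fin]
  intro σ τ h
  exact Equiv.ext fun i => hinj A hA (congrFun h i)

end Unordered

/-! ### Centring -/

section Centre

/-- As `0 ∈ A`, the least element of the centred set is `-(max A) / 2`, so the translation can be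
undone. -/
theorem centre_injOn : Set.InjOn centre {A | 0 ∈ A} := by
  have key : ∀ A B : Finset ℕ, 0 ∈ A → centre A = centre B → A.sup id ≤ B.sup id := by
    intro A B hA h
    have h1 : (((0 : ℕ) : ℚ) - ((A.sup id : ℕ) : ℚ) / 2) ∈ centre A :=
      Finset.mem_image.mpr ⟨0, hA, rfl⟩
    rw [h] at h1
    obtain ⟨b, -, hb⟩ := Finset.mem_image.mp h1
    have hb0 : (0 : ℚ) ≤ b := b.cast_nonneg
    rw [← Nat.cast_le (α := ℚ)]
    push_cast at hb ⊢
    linarith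
  intro A hA B hB h
  have hs := le_antisymm (key A B hA h) (key B A hB h.symm)
  unfold centre at h
  rw [hs] at h
  exact Finset.image_injective (fun a b e => by simpa using e) h

end Centre

/-! ### Counting systems, centred and unordered -/

section SumSystems

variable {m N : ℕ} {A : Fin m → Finset ℕ}

theorem zero_mem_of_mem_sumSystems (hN : 0 < N) (hA : A ∈ sumSystems m N) (i : Fin m) :
    0 ∈ A i :=
  hA.1.zero_mem hN i

theorem injective_of_mem_sumSystems (hN : 0 < N) (hA : A ∈ sumSystems m N) : A.Injective := by
  intro i j hij
  by_contra hne
  obtain ⟨l, hl, rfl⟩ := hA.1.exists_systemOfChain hN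
  obtain ⟨x, hx, hx0⟩ := Finset.exists_mem_ne (hA.2 i) 0
  exact hx0 (eq_zero_of_mem_systemOfChain hl hne hx (hij ▸ hx))

theorem comp_perm_mem_sumSystems (hA : A ∈ sumSystems m N) (σ : Equiv.Perm (Fin m)) :
    A ∘ σ ∈ sumSystems m N := by
  refine ⟨⟨?_, ?_⟩, fun j => hA.2 (σ j)⟩
  · rw [← hA.1.1]
    exact Equiv.prod_comp σ fun j => (A j).card
  · rw [← hA.1.2]
    exact Equiv.sum_comp σ A

theorem centredSumSystems_eq_image (m N : ℕ) :
    centredSumSystems m N = (fun A j => centre (A j)) '' sumSystems m N := by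
  ext C
  constructor
  · rintro ⟨A, hA, h⟩
    exact ⟨A, hA, funext fun j => (h j).symm⟩
  · rintro ⟨A, hA, rfl⟩
    exact ⟨A, hA, fun _ => rfl⟩

theorem ncard_centredSumSystems (m : ℕ) (hN : 0 < N) :
    (centredSumSystems m N).ncard = numSumSystems m N := by
  rw [centredSumSystems_eq_image, numSumSystems]
  refine Set.InjOn.ncard_image fun A hA B hB h => funext fun j => ?_
  exact centre_injOn (zero_mem_of_mem_sumSystems hN hA j) (zero_mem_of_mem_sumSystems hN hB j)
    (congrFun h j)

theorem ncard_unordered_sumSystems (m : ℕ) (hN : 0 < N) :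
    (unordered (sumSystems m N)).ncard * m.factorial = numSumSystems m N :=
  ncard_unordered_mul_factorial (sumSystems_finite m N)
    (fun _ => injective_of_mem_sumSystems hN) fun _ => comp_perm_mem_sumSystems

theorem ncard_unordered_centredSumSystems (m : ℕ) (hN : 0 < N) :
    (unordered (centredSumSystems m N)).ncard * m.factorial = numSumSystems m N := by
  rw [← ncard_centredSumSystems m hN]
  refine ncard_unordered_mul_factorial ?_ ?_ ?_
  · rw [centredSumSystems_eq_image]
    exact (sumSystems_finite m N).image _
  · rintro C ⟨A, hA, h⟩ i j hij
    rw [h, h] at hij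
    exact injective_of_mem_sumSystems hN hA (centre_injOn (zero_mem_of_mem_sumSystems hN hA i)
      (zero_mem_of_mem_sumSystems hN hA j) hij)
  · rintro C ⟨A, hA, h⟩ σ
    exact ⟨A ∘ σ, comp_perm_mem_sumSystems hA σ, fun j => h (σ j)⟩

end SumSystems

theorem theorem4p1 (m N : ℕ) (hm : 1 ≤ m) (hN : 2 ≤ N) :
    -- the objects that `𝒩` counts
    (centredSumSystems m N).ncard = numSumSystems m N ∧
    (jointOrderedFactorisations m N).ncard = numSumSystems m N ∧
    -- the relations for `𝒩`
    (numSumSystems m N : ℤ) = ∑ d ∈ N.properDivisors,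
      (((m : ℤ) - 1) * numSumSystems m d + (m : ℤ) * numSumSystems (m - 1) d) ∧
    (numSumSystems m N : ℤ) = -(m : ℤ) * ∑ d ∈ N.properDivisors,
      ArithmeticFunction.moebius (N / d) *
        ((numSumSystems m d : ℤ) + numSumSystems (m - 1) d) ∧
    -- the objects that `ℳ` counts
    ((unordered (sumSystems m N)).ncard : ℚ) = normSumSystems m N ∧
    ((unordered (centredSumSystems m N)).ncard : ℚ) = normSumSystems m N ∧
    -- the relations for `ℳ`
    normSumSystems m N = ∑ d ∈ N.properDivisors,
      (((m : ℚ) - 1) * normSumSystems m d + normSumSystems (m - 1) d) ∧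
    normSumSystems m N = -∑ d ∈ N.properDivisors,
      (ArithmeticFunction.moebius (N / d) : ℚ) *
        ((m : ℚ) * normSumSystems m d + normSumSystems (m - 1) d) := by
  have hN0 : 0 < N := by omega
  have hrec : ∀ n > 0, (numSumSystems m n : ℤ) = ∑ d ∈ n.properDivisors,
      (((m : ℤ) - 1) * numSumSystems m d + (m : ℤ) * numSumSystems (m - 1) d) := by
    intro n hn
    rw [numSumSystems_eq_sum hm hn]
    push_cast [Nat.cast_sub hm]
    rfl
  have hmoe := eq_neg_mul_sum_moebius (a := fun n => numSumSystems m n)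
    (b := fun n => numSumSystems (m - 1) n) hrec hN0
  have hfac : (m.factorial : ℚ) ≠ 0 := Nat.cast_ne_zero.mpr m.factorial_ne_zero
  have hnorm : ∀ n, (numSumSystems m n : ℚ) = m.factorial * normSumSystems m n := fun n => by
    rw [normSumSystems, mul_div_cancel₀ _ hfac]
  -- The identity `m! = m * (m - 1)!` absorbs the factor `m`, which is why `normSumSystems (m - 1)`
  -- carries none in the normalised relations.
  have hnorm' : ∀ n, (m : ℚ) * numSumSystems (m - 1) n =
      m.factorial * normSumSystems (m - 1) n := fun n => by
    rw [normSumSystems, ← Nat.mul_factorial_pred (by omega : m ≠ 0)]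
    have : ((m - 1).factorial : ℚ) ≠ 0 := Nat.cast_ne_zero.mpr (m - 1).factorial_ne_zero
    push_cast
    field_simp
  refine ⟨ncard_centredSumSystems m hN0, ?_, hrec N hN0, hmoe, ?_, ?_, ?_, ?_⟩
  · rw [jointOrderedFactorisations_eq, ncard_factorChains_univ m hN0]
  · rw [normSumSystems, eq_div_iff hfac]
    exact_mod_cast ncard_unordered_sumSystems m hN0
  · rw [normSumSystems, eq_div_iff hfac]
    exact_mod_cast ncard_unordered_centredSumSystems m hN0
  · refine mul_left_cancel₀ hfac ?_
    have h := congrArg (Int.cast : ℤ → ℚ) (hrec N hN0)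
    push_cast at h
    rw [← hnorm, h, Finset.mul_sum]
    refine Finset.sum_congr rfl fun d _ => ?_
    rw [hnorm, hnorm']
    ring
  · refine mul_left_cancel₀ hfac ?_
    have h := congrArg (Int.cast : ℤ → ℚ) hmoe
    push_cast at h
    rw [← hnorm, h, neg_mul, mul_neg, Finset.mul_sum, Finset.mul_sum]
    refine congrArg Neg.neg (Finset.sum_congr rfl fun d _ => ?_)
    have h1 := hnorm' d
    have h2 := hnorm d
    linear_combination (ArithmeticFunction.moebius (N / d) : ℚ) * (h1 + m * h2)
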